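/- Conventions. A digraph $D=(V,E)$, $E\subseteq V^2$, has no loops and no two opposite arcs ($uv\in E$ implies $vu\notin E$). An orientation of a graph $G$ is a digraph on the vertex set of $G$ containing exactly one of the arcs $uv$, $vu$ for each edge $\{u,v\}$ of $G$, and no other arcs. A set of vertices $W$ is acyclic in $D$ if the induced subdigraph $D[W]$ contains no directed cycle; the dichromatic number $\chi(D)$ is the least cardinal number of acyclic sets that cover the vertices of $D$; and $\vec\chi(G)=\sup\{\chi(D): D\text{ is an orientation of }G\}$. For a cardinal $\kappa$ put $\exp_0(\kappa)=\kappa$ and $\exp_{n+1}(\kappa)=2^{\exp_n(\kappa)}$. For a cardinal $\lambda$ (an initial ordinal), $\mathrm{Sh}_n(\lambda)$ is the graph whose vertices are the $n$-element subsets of $\lambda$ and whose edges are the pairs $\{\xi_0,\dots,\xi_{n-1}\}$, $\{\xi_1,\dots,\xi_n\}$ with $\xi_0<\xi_1<\dots<\xi_n$ in $\lambda$. The underlying graph of a digraph is obtained by forgetting the directions of its arcs. The odd girth of a graph is the length of its shortest odd cycle ($\infty$ if there is none). A digraph $F$ embeds into $D$ if it is isomorphic to a not necessarily induced subdigraph of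 $D$. Theorem. (1) For all natural numbers $n\ge 2$ and all infinite cardinals $\kappa$, the graph $\mathrm{Sh}_n(\exp_n(\kappa))$ has an orientation $D$ such that for every colouring of the vertices of $D$ with $\kappa$ colours there is a monochromatic copy of the directed cycle with $4$ vertices. In particular, $\vec\chi(\mathrm{Sh}_n(\exp_n(\kappa)))>\kappa$. (2) For every cardinal $\kappa$ and every natural number $k$ there is a digraph $D$ with $\chi(D)>\kappa$ whose underlying graph has odd girth greater than $k$. (3) If a digraph $F$ embeds into every digraph $D$ with $\chi(D)>\aleph_0$, then the underlying graph of $F$ is bipartite. -/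

import Mathlib

open Cardinal

universe u v w

/-- No loops and no pair of opposite arcs: the digraphs considered in the theorem. -/
def Digraph.IsOriented {V : Type u} (D : Digraph V) : Prop :=
  ∀ a b : V, D.Adj a b → ¬ D.Adj b a

/-- `D` is an orientation of the simple graph `G`: every edge of `G` is an arc of `D` in exactly
one of its two directions, and `D` has no other arcs. -/
def Digraph.IsOrientationOf {V : Type u} (D : Digraph V) (G : SimpleGraph V) : Prop :=
  D.IsOriented ∧ ∀ a b : V, G.Adj a b ↔ (D.Adj a b ∨ D.Adj b a)

/-- The induced subdigraph `D[W]` contains a (not necessarily induced) copy of `D₀`. -/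
def Digraph.EmbedsOn {V₀ : Type v} {V : Type u} (D₀ : Digraph V₀) (D : Digraph V)
    (W : Set V) : Prop :=
  ∃ f : V₀ ↪ V, (∀ x, f x ∈ W) ∧ ∀ x y, D₀.Adj x y → D.Adj (f x) (f y)

/-- `D₀` embeds into `D` as a not necessarily induced subdigraph. -/
def Digraph.Embeds {V₀ : Type v} {V : Type u} (D₀ : Digraph V₀) (D : Digraph V) : Prop :=
  D₀.EmbedsOn D Set.univ

/-- The directed cycle with `k` vertices `0 → 1 → ⋯ → k - 1 → 0`. -/
def Digraph.dicycle (k : ℕ) : Digraph (Fin k) where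
  Adj i j := (j : ℕ) = ((i : ℕ) + 1) % k

/-- `W` is an acyclic set of vertices: `D[W]` contains no directed cycle. -/
def Digraph.IsAcyclicSet {V : Type u} (D : Digraph V) (W : Set V) : Prop :=
  ∀ k : ℕ, 1 ≤ k → ¬ (Digraph.dicycle k).EmbedsOn D W

/-- The dichromatic number: the least number of acyclic sets that cover the vertices. -/
noncomputable def Digraph.dichromaticNumber {V : Type u} (D : Digraph V) : Cardinal.{u} :=
  sInf {c | ∃ S : Set (Set V), #S = c ∧ ⋃₀ S = Set.univ ∧ ∀ W ∈ S, D.IsAcyclicSet W}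

/-- `D → (D₀)¹_r`: every colouring of the vertices of `D` with a set of `r` colours admits a
monochromatic copy of `D₀`. -/
def Digraph.Arrow {V : Type u} {V₀ : Type v} (D : Digraph V) (D₀ : Digraph V₀)
    (r : Cardinal.{w}) : Prop :=
  ∀ C : Type w, #C = r → ∀ c : V → C, ∃ i : C, D₀.EmbedsOn D {x | c x = i}

/-- The supremum of the dichromatic numbers of all orientations of `G`. -/
noncomputable def SimpleGraph.orientationDichromaticNumber {V : Type u} (G : SimpleGraph V) :
    Cardinal.{u} :=
  ⨆ D : {D : Digraph V // D.IsOrientationOf G}, D.1.dichromaticNumber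

/-- The length of a shortest odd cycle, or `⊤` if there is none. -/
noncomputable def SimpleGraph.oddGirth {V : Type u} (G : SimpleGraph V) : ℕ∞ :=
  ⨅ (a : V) (p : G.Walk a a) (_ : p.IsCycle ∧ Odd p.length), (p.length : ℕ∞)

/-- Iterated exponentials: `κ`, `2 ^ κ`, `2 ^ 2 ^ κ`, … -/
noncomputable def Cardinal.iterExp (κ : Cardinal.{u}) : ℕ → Cardinal.{u}
  | 0 => κ
  | n + 1 => 2 ^ Cardinal.iterExp κ n

/-- The shift graph on the `n`-element subsets of a linear order `α`, with edges
`{ξ₀, …, ξₙ₋₁}{ξ₁, …, ξₙ}` for `ξ₀ < ⋯ < ξₙ`. -/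
def shiftGraphOn (n : ℕ) (α : Type u) [LinearOrder α] : SimpleGraph (Set.powersetCard α n) :=
  SimpleGraph.fromRel fun s t =>
    ∃ ξ : Fin (n + 1) → α, StrictMono ξ ∧
      (s : Finset α) = Finset.univ.image (fun i : Fin n => ξ i.castSucc) ∧
      (t : Finset α) = Finset.univ.image (fun i : Fin n => ξ i.succ)

/-- The shift graph `Sh_n(lam)` of a cardinal `lam`, seen as an initial ordinal. -/
noncomputable def shiftGraph (n : ℕ) (lam : Cardinal.{u}) :
    SimpleGraph (Set.powersetCard lam.ord.ToType n) :=
  shiftGraphOn n lam.ord.ToType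

/-! Let `N` have size `exp_m(κ)` with `n = m + 1`, and let `L` have size `2 ^ #N`. Choose `S` on `L`
taking each set of at most `#N` finite sets as a value unboundedly often, and direct a shift edge
upwards iff its lower end lies in `S c`, `c` the maximum of its upper end. Points `a, a'` below `y`
and `c, c'` above it then give a directed 4-cycle as soon as `S c` and `S c'` separate `insert a y`
from `insert a' y` in opposite ways. Sets of `c` without such a separation generate an ideal of
small sets; a diagonal choice of `S c` shows that `L` is not small (`not_isSmall_univ`). By
induction on `m`, each colouring has a `y` with `#N` points below and a non-small set above, all
giving one colour (`exists_shift_fiber`); non-smallness supplies the cycle. For (2) and (3), an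
element in the middle of a vertex of `Sh_n` moves by one position per edge, so short closed walks
are even. -/

/-! ### The ideal of small sets. -/

section SmallSets

variable {L : Type u} [LinearOrder L] {N : Type u}

/-- A set `B` is *basic* for `S` if it is bounded, or if, for some finite set `y` and some set `A`
of at least `#N` points below `y`, no two points of `A` are separated both ways by `S` on `B`. -/
def IsBasicSmall (N : Type u) (S : L → Set (Finset L)) (B : Set L) : Prop :=
  (∃ x, ∀ c ∈ B, c ≤ x) ∨
    ∃ (y : Finset L) (A : Set L), #N ≤ #A ∧ (∀ a ∈ A, ∀ x ∈ y, a < x) ∧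
      ∀ a ∈ A, ∀ a' ∈ A, ∀ c ∈ B, ∀ c' ∈ B,
        ¬ (insert a y ∈ S c ∧ insert a' y ∉ S c ∧ insert a' y ∈ S c' ∧ insert a y ∉ S c')

/-- A set is *small* if it is covered by `#N` basic sets. -/
def IsSmall (N : Type u) (S : L → Set (Finset L)) (B : Set L) : Prop :=
  ∃ F : N → Set L, (∀ j, IsBasicSmall N S (F j)) ∧ B ⊆ ⋃ j, F j

theorem IsSmall.mono {S : L → Set (Finset L)} {B B' : Set L} (h : IsSmall N S B)
    (hB : B' ⊆ B) : IsSmall N S B' := by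
  obtain ⟨F, hF, hc⟩ := h
  exact ⟨F, hF, hB.trans hc⟩

theorem IsBasicSmall.isSmall [Nonempty N] {S : L → Set (Finset L)} {B : Set L}
    (h : IsBasicSmall N S B) : IsSmall N S B :=
  ⟨fun _ => B, fun _ => h, fun _ hx => Set.mem_iUnion.2 ⟨Classical.arbitrary N, hx⟩⟩

theorem IsSmall.iUnion [Infinite N] {S : L → Set (Finset L)} {ι : Type u} (hι : #ι ≤ #N)
    [Nonempty L] {B : ι → Set L} (h : ∀ i, IsSmall N S (B i)) : IsSmall N S (⋃ i, B i) := by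
  choose F hF hB using h
  have hcard : #(ι × N) ≤ #N := by
    rw [mk_prod, lift_id, lift_id]
    exact (mul_le_mul_left hι _).trans_eq (mul_eq_self (aleph0_le_mk N))
  obtain ⟨e⟩ := hcard
  classical
  refine ⟨fun j => {x | ∃ p, e p = j ∧ x ∈ F p.1 p.2}, fun j => ?_, ?_⟩
  · by_cases hj : ∃ p, e p = j
    · obtain ⟨p, rfl⟩ := hj
      convert hF p.1 p.2 using 1
      ext x
      simp
    · refine Or.inl ⟨Classical.arbitrary L, ?_⟩
      rintro c ⟨p, hp, -⟩
      exact (hj ⟨p, hp⟩).elim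
  · intro x hx
    obtain ⟨i, hi⟩ := Set.mem_iUnion.1 hx
    obtain ⟨j, hj⟩ := Set.mem_iUnion.1 (hB i hi)
    exact Set.mem_iUnion.2 ⟨e (i, j), (i, j), rfl, hj⟩

theorem IsSmall.union [Infinite N] [Nonempty L] {S : L → Set (Finset L)} {B B' : Set L}
    (h : IsSmall N S B) (h' : IsSmall N S B') : IsSmall N S (B ∪ B') := by
  have := IsSmall.iUnion (N := N) (S := S) (ι := ULift.{u} Bool)
    (B := fun i => if i.down then B else B')
    ((lt_aleph0_of_finite _).le.trans (aleph0_le_mk N))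
    (by rintro ⟨_ | _⟩ <;> simpa)
  refine this.mono ?_
  rintro x (hx | hx)
  · exact Set.mem_iUnion.2 ⟨⟨true⟩, by simpa⟩
  · exact Set.mem_iUnion.2 ⟨⟨false⟩, by simpa⟩

/-- A family of large sets, indexed by a set whose size they all have, has an injective choice
function. -/
theorem exists_injective_mem_of_mk_le {ι α : Type u} (A : ι → Set α) (hA : ∀ i, #ι ≤ #(A i)) :
    ∃ h : ι → α, Function.Injective h ∧ ∀ i, h i ∈ A i := by
  -- In the initial well-order, fewer than `#ι` values precede each stage of the recursion.
  obtain ⟨_, _, hord⟩ := exists_ord_eq_type_lt ι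
  have key : ∀ (i : ι) (g : Set.Iio i → α), ∃ a ∈ A i, a ∉ Set.range g := by
    intro i g
    by_contra! hc
    have h1 : #(A i) ≤ #(Set.range g) := mk_le_mk_of_subset hc
    exact ((hA i).trans (h1.trans mk_range_le)).not_gt (mk_Iio_lt i hord)
  choose f hf hf' using key
  let h : ι → α := wellFounded_lt.fix fun i g => f i fun j => g j.1 j.2
  have hh : ∀ i, h i = f i fun j => h j.1 := fun i => wellFounded_lt.fix_eq _ i
  have hne : ∀ i j, j < i → h j ≠ h i := by
    intro i j hji he
    refine hf' i (fun j => h j.1) ⟨⟨j, hji⟩, ?_⟩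
    rw [← hh i]
    exact he
  refine ⟨h, fun i j hij => ?_, fun i => ?_⟩
  · rcases lt_trichotomy i j with hlt | heq | hlt
    · exact (hne _ _ hlt hij).elim
    · exact heq
    · exact (hne _ _ hlt hij.symm).elim
  · rw [hh i]
    exact hf i _

/-- Both points are the minimum of the common set. -/
theorem insert_eq_insert_of_lt {a a' : L} {y y' : Finset L} (ha : ∀ x ∈ y, a < x)
    (ha' : ∀ x ∈ y', a' < x) (h : insert a y = insert a' y') : a = a' := by
  have h1 : a ∈ insert a' y' := h ▸ Finset.mem_insert_self a y
  have h2 : a' ∈ insert a y := h ▸ Finset.mem_insert_self a' y'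
  rcases Finset.mem_insert.1 h1 with h1 | h1
  · exact h1
  rcases Finset.mem_insert.1 h2 with h2 | h2
  · exact h2.symm
  exact (lt_asymm (ha _ h2) (ha' _ h1)).elim

/-- If `S` takes every set of at most `#N` finite sets as a value unboundedly often, then the
whole order is not small. -/
theorem not_isSmall_univ [Infinite N] [Nonempty L] {S : L → Set (Finset L)}
    (hbdd : ∀ f : N → L, ∃ x, ∀ j, f j ≤ x)
    (hS : ∀ (Q : N → Finset L) (x : L), ∃ c, x < c ∧ S c = Set.range Q) :
    ¬ IsSmall N S (Set.univ : Set L) := by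
  classical
  rintro ⟨F, hF, hc⟩
  let J := {j : N // ¬ ∃ x, ∀ c ∈ F j, c ≤ x}
  choose y A hA hlt hpat using fun j : J => (hF j.1).resolve_left j.2
  obtain ⟨h, hinj, hmem⟩ := exists_injective_mem_of_mk_le
    (fun p : J × Bool => A p.1) (by
      intro p
      have hinf := aleph0_le_mk N
      refine le_trans ?_ (hA p.1)
      rw [mk_prod, lift_uzero]
      exact mul_le_of_le hinf (mk_subtype_le _)
        ((lift_lt_aleph0.2 (lt_aleph0_of_finite Bool)).le.trans hinf))
  -- On the piece `F j` at least one of the two directions of separation never occurs.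
  have hbit : ∀ j : J, ∃ b : Bool, ∀ c ∈ F j.1,
      ¬ (insert (h (j, b)) (y j) ∈ S c ∧ insert (h (j, !b)) (y j) ∉ S c) := by
    intro j
    by_contra! hcon
    obtain ⟨c, hc, h1, h2⟩ := hcon true
    obtain ⟨c', hc', h3, h4⟩ := hcon false
    exact hpat j _ (hmem (j, true)) _ (hmem (j, false)) c hc c' hc' ⟨h1, h2, h3, h4⟩
  choose b hb using hbit
  obtain ⟨x₀, hx₀⟩ := hbdd fun j => if hj : ∃ x, ∀ c ∈ F j, c ≤ x then hj.choose else
    Classical.arbitrary L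
  -- Diagonalization: `S c` separates each pair in its forbidden direction, and `c` exceeds all
  -- bounded pieces. The filler `∅` is never of the form `insert _ _`.
  obtain ⟨c, hcx, hSc⟩ := hS (fun j => if hj : ∃ x, ∀ c ∈ F j, c ≤ x then ∅ else
    insert (h (⟨j, hj⟩, b ⟨j, hj⟩)) (y ⟨j, hj⟩)) x₀
  obtain ⟨j, hcj⟩ := Set.mem_iUnion.1 (hc (Set.mem_univ c))
  by_cases hj : ∃ x, ∀ c ∈ F j, c ≤ x
  · have h1 := hx₀ j
    rw [dif_pos hj] at h1
    exact ((hj.choose_spec c hcj).trans h1).not_gt hcx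
  · refine hb ⟨j, hj⟩ c hcj ⟨?_, ?_⟩
    · rw [hSc]
      exact ⟨j, dif_neg hj⟩
    · rw [hSc]
      rintro ⟨j', hj'⟩
      by_cases hjj : ∃ x, ∀ c ∈ F j', c ≤ x
      · simp only [dif_pos hjj] at hj'
        exact (Finset.insert_ne_empty _ _ hj'.symm).elim
      · simp only [dif_neg hjj] at hj'
        have heq := insert_eq_insert_of_lt (hlt ⟨j', hjj⟩ _ (hmem (⟨j', hjj⟩, b ⟨j', hjj⟩))) (hlt ⟨j, hj⟩ _
          (hmem (⟨j, hj⟩, !b ⟨j, hj⟩))) hj'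
        have h2 := hinj heq
        simp only [Prod.mk.injEq] at h2
        obtain ⟨h3, h4⟩ := h2
        rw [h3] at h4
        exact (Bool.not_ne_self _ h4.symm).elim

/-! ### Colourings with large lower fibres and non-small upper fibres. -/

/-- The points of a set lying above all of `y` whose addition to `y` gets the colour `i`. -/
def upperFiber {K : Type w} (g : Finset L → K) (y : Finset L) (i : K) : Set L :=
  {c | (∀ x ∈ y, x < c) ∧ g (insert c y) = i}

/-- The exponential tower reindexed from the top. -/
theorem iterExp_two_power (κ : Cardinal.{u}) (n : ℕ) :
    Cardinal.iterExp (2 ^ κ) n = κ.iterExp (n + 1) := by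
  induction n with
  | zero => rfl
  | succ n ih => rw [Cardinal.iterExp, ih]; rfl

theorem le_iterExp (κ : Cardinal.{u}) (n : ℕ) : κ ≤ κ.iterExp n := by
  induction n with
  | zero => exact le_rfl
  | succ n ih => exact ih.trans (cantor _).le

theorem lt_cof_iterExp_succ {κ : Cardinal.{u}} (hκ : ℵ₀ ≤ κ) (n : ℕ) :
    κ < (κ.iterExp (n + 1)).ord.cof :=
  (le_iterExp κ n).trans_lt (lt_cof_ord_power (hκ.trans (le_iterExp κ n)) one_lt_two)

theorem mk_le_of_not_isSmall [Infinite N] {S : L → Set (Finset L)} {B : Set L}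
    (hB : ¬ IsSmall N S B) [Nonempty L] : #N ≤ #B := by
  by_contra! hlt
  refine hB ((IsSmall.iUnion (N := N) (S := S) hlt.le (B := fun x : B => {x.1})
    fun x => IsBasicSmall.isSmall (Or.inl ⟨x.1, by simp⟩)).mono ?_)
  intro x hx
  exact Set.mem_iUnion.2 ⟨⟨x, hx⟩, rfl⟩

/-- The induction trades one exponential for one more element of `y`: the case `m` is applied to the
colouring of a set by the set of colours whose upper fibre is not small. -/
theorem exists_shift_fiber [Infinite N] [Nonempty L] {S : L → Set (Finset L)}
    (hbdd : ∀ f : N → L, ∃ x, ∀ j, f j ≤ x) (huniv : ¬ IsSmall N S (Set.univ : Set L)) (m : ℕ) :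
    ∀ (K : Type u), ℵ₀ ≤ #K → #N = (#K).iterExp m → ∀ g : Finset L → K,
      ∃ (i : K) (y : Finset L) (A : Set L), y.card = m ∧ #A = #N ∧ (∀ a ∈ A, ∀ x ∈ y, a < x) ∧
        (∀ a ∈ A, g (insert a y) = i) ∧
        ¬ IsSmall N S {c | (∀ x ∈ y, x < c) ∧ (∀ a ∈ A, a < c) ∧ g (insert c y) = i} := by
  induction m with
  | zero =>
    intro K hK hN g
    have h1 : ∃ i, ¬ IsSmall N S {c | g {c} = i} := by
      by_contra! hcon
      refine huniv ((IsSmall.iUnion (hN.ge.trans' (le_iterExp _ _)) hcon).mono ?_)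
      intro x _
      exact Set.mem_iUnion.2 ⟨_, rfl⟩
    obtain ⟨i, hi⟩ := h1
    obtain ⟨A, hA, hAN⟩ := le_mk_iff_exists_subset.1 (mk_le_of_not_isSmall hi)
    refine ⟨i, ∅, A, rfl, hAN, by simp, fun a ha => ?_, fun hs => hi ?_⟩
    · simpa using hA ha
    · obtain ⟨e⟩ := Cardinal.eq.1 hAN
      obtain ⟨x, hx⟩ := hbdd fun j => (e.symm j).1
      refine (hs.union (IsBasicSmall.isSmall (B := Set.Iic x) (Or.inl ⟨x, fun _ h => h⟩))).mono ?_
      intro c hc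
      rcases le_or_gt c x with hcx | hcx
      · exact Or.inr hcx
      · refine Or.inl ⟨by simp, fun a ha => ?_, by simpa using hc⟩
        have := hx (e ⟨a, ha⟩)
        rw [e.symm_apply_apply] at this
        exact this.trans_lt hcx
  | succ m ih =>
    intro K hK hN g
    let T : Finset L → Set K := fun y => {i | ¬ IsSmall N S (upperFiber g y i)}
    obtain ⟨I, z, A, hz, hA, hAz, hAI, hC⟩ := ih (Set K)
      (by rw [mk_set]; exact hK.trans (cantor _).le)
      (by rw [mk_set, iterExp_two_power]; exact hN) T
    have hNK : #K ≤ #N := hN.ge.trans' (le_iterExp _ _)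
    -- Removing all small fibres over `A` at once leaves a `c` for which every `insert a (insert c
    -- z)` has a colour in `I`.
    have hsm : IsSmall N S (⋃ a : A, ⋃ i : ((T (insert a.1 z))ᶜ : Set K),
        upperFiber g (insert a.1 z) i.1) := by
      refine IsSmall.iUnion hA.le fun a => IsSmall.iUnion ((mk_set_le _).trans hNK) fun i => ?_
      exact not_not.1 i.2
    obtain ⟨c, hc, hcn⟩ := Set.not_subset.1 fun hsub => hC (hsm.mono hsub)
    obtain ⟨hcz, hcA, hcI⟩ := hc
    have hcz' : c ∉ z := fun h => lt_irrefl _ (hcz c h)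
    have hcol : ∀ a ∈ A, g (insert a (insert c z)) ∈ I := by
      intro a ha
      rw [← hAI a ha, Finset.insert_comm]
      by_contra hnot
      refine hcn (Set.mem_iUnion.2 ⟨⟨a, ha⟩, Set.mem_iUnion.2 ⟨⟨_, hnot⟩, ?_, rfl⟩⟩)
      intro x hx
      rcases Finset.mem_insert.1 hx with rfl | hx
      · exact hcA _ ha
      · exact hcz x hx
    -- One colour `i ∈ I` serves `#N` points of `A`; as `I = T (insert c z)`, its upper fibre over
    -- the new `y` is not small.
    obtain ⟨i, A', hA', hA'N, hA'i⟩ := infinite_pigeonhole_set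
      (fun a : A => g (insert a.1 (insert c z))) #N hA.ge (aleph0_le_mk N)
      (by rw [hN]; exact lt_cof_iterExp_succ hK m)
    have hiI : i ∈ T (insert c z) := by
      have : (A').Nonempty := by
        rw [Set.nonempty_iff_ne_empty]
        rintro rfl
        simp at hA'N
      obtain ⟨a, ha⟩ := this
      rw [hcI, ← hA'i ha]
      exact hcol a (hA' ha)
    refine ⟨i, insert c z, A', by rw [Finset.card_insert_of_notMem hcz', hz],
      le_antisymm ((mk_le_mk_of_subset hA').trans hA.le) hA'N, ?_, fun a ha => hA'i ha, ?_⟩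
    · intro a ha x hx
      rcases Finset.mem_insert.1 hx with rfl | hx
      · exact hcA _ (hA' ha)
      · exact hAz a (hA' ha) x hx
    · intro hs
      refine hiI (hs.mono ?_)
      rintro d ⟨hd, hdi⟩
      exact ⟨hd, fun a ha => (hcA a (hA' ha)).trans (hd c (Finset.mem_insert_self _ _)), hdi⟩

/-- The two-by-two pattern whose colour is constant. -/
theorem exists_monochromatic_pattern [Infinite N] [Nonempty L] {S : L → Set (Finset L)}
    (hbdd : ∀ f : N → L, ∃ x, ∀ j, f j ≤ x)
    (hS : ∀ (Q : N → Finset L) (x : L), ∃ c, x < c ∧ S c = Set.range Q)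
    {m : ℕ} {K : Type u} (hK : ℵ₀ ≤ #K) (hN : #N = (#K).iterExp m) (g : Finset L → K) :
    ∃ (i : K) (y : Finset L) (a a' c c' : L), y.card = m ∧
      (∀ x ∈ y, a < x ∧ a' < x ∧ x < c ∧ x < c') ∧ a < c ∧ a < c' ∧ a' < c ∧ a' < c' ∧
      g (insert a y) = i ∧ g (insert a' y) = i ∧ g (insert c y) = i ∧ g (insert c' y) = i ∧
      insert a y ∈ S c ∧ insert a' y ∉ S c ∧ insert a' y ∈ S c' ∧ insert a y ∉ S c' := by
  obtain ⟨i, y, A, hy, hA, hAy, hAi, hC⟩ :=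
    exists_shift_fiber hbdd (not_isSmall_univ hbdd hS) m K hK hN g
  by_contra hcon
  refine hC (IsBasicSmall.isSmall (Or.inr ⟨y, A, hA.ge, hAy, ?_⟩))
  rintro a ha a' ha' c ⟨h1, h2, h3⟩ c' ⟨h4, h5, h6⟩ ⟨h7, h8, h9, h10⟩
  exact hcon ⟨i, y, a, a', c, c', hy,
    fun x hx => ⟨hAy a ha x hx, hAy a' ha' x hx, h1 x hx, h4 x hx⟩,
    h2 a ha, h5 a ha, h2 a' ha', h5 a' ha', hAi a ha, hAi a' ha', h3, h6, h7, h8, h9, h10⟩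

end SmallSets

/-! ### Cofinality and unbounded repetition. -/

theorem exists_bound_of_mk_lt_cof {c : Cardinal.{u}} {N : Type u} (h : #N < c.ord.cof)
    (f : N → c.ord.ToType) : ∃ x, ∀ j, f j ≤ x := by
  by_contra! hcon
  have h1 : IsCofinal (Set.range f) := by
    intro x
    obtain ⟨j, hj⟩ := hcon x
    exact ⟨f j, ⟨j, rfl⟩, hj.le⟩
  have h2 := Order.cof_le h1
  rw [Ordinal.cof_toType] at h2
  exact ((h2.trans mk_range_le).trans_lt h).false

theorem mk_Iic_lt_of_aleph0_le {c : Cardinal.{u}} (hc : ℵ₀ ≤ c) (x : c.ord.ToType) :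
    #(Set.Iic x) < c := by
  have h1 : #(Set.Iio x) < c := by simpa using mk_Iio_lt x
  rw [← Set.Iio_insert]
  exact mk_insert_le.trans_lt (add_lt_of_lt hc h1 (one_lt_aleph0.trans_le hc))

/-- Every set of at most `ν` finite subsets of `2 ^ ν` is a value taken unboundedly often. -/
theorem exists_range_eq_unboundedly {N : Type u} [Infinite N] :
    ∃ S : ((2 : Cardinal.{u}) ^ #N).ord.ToType → Set (Finset ((2 : Cardinal.{u}) ^ #N).ord.ToType),
      ∀ (Q : N → Finset ((2 : Cardinal.{u}) ^ #N).ord.ToType) x, ∃ c, x < c ∧ S c = Set.range Q := by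
  set c : Cardinal.{u} := 2 ^ #N with hc
  have hN := aleph0_le_mk N
  have hcN : ℵ₀ ≤ c := hN.trans (cantor _).le
  have hL : #c.ord.ToType = c := mk_ord_toType c
  have : Infinite c.ord.ToType := by rwa [infinite_iff, hL]
  -- The second factor makes each `Q` occur `c` times, too often for an initial segment.
  have hcard : #c.ord.ToType = #((N → Finset c.ord.ToType) × c.ord.ToType) := by
    rw [mk_prod, lift_id, lift_id, ← power_def, mk_finset_of_infinite, hL, hc, ← power_mul,
      mul_eq_self hN, mul_eq_self (hN.trans (cantor _).le)]
  obtain ⟨e⟩ := Cardinal.eq.1 hcard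
  refine ⟨fun x => Set.range (e x).1, fun Q x => ?_⟩
  by_contra! hcon
  have hle : ∀ z, e.symm (Q, z) ≤ x := by
    intro z
    by_contra! hlt
    exact hcon _ hlt (by simp)
  have h1 : #c.ord.ToType ≤ #(Set.Iic x) := by
    refine mk_le_of_injective (f := fun z => ⟨e.symm (Q, z), hle z⟩) ?_
    intro z z' hz
    have hz' := congrArg Subtype.val hz
    simpa using hz'
  rw [hL] at h1
  exact (h1.trans_lt (mk_Iic_lt_of_aleph0_le hcN x)).false

/-! ### Shift graphs and their orientation. -/

section Shift

variable {n : ℕ} {α : Type u} [LinearOrder α]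

/-- `t` arises from `s` by one shift. -/
def ShiftRel (s t : Finset α) (n : ℕ) : Prop :=
  ∃ ξ : Fin (n + 1) → α, StrictMono ξ ∧
    s = Finset.univ.image (fun i : Fin n => ξ i.castSucc) ∧
    t = Finset.univ.image (fun i : Fin n => ξ i.succ)

theorem shiftGraphOn_adj {s t : Set.powersetCard α n} :
    (shiftGraphOn n α).Adj s t ↔ s ≠ t ∧ (ShiftRel (s : Finset α) t n ∨ ShiftRel (t : Finset α) s n) :=
  Iff.rfl

theorem ShiftRel.exists_lt (hn : n ≠ 0) {s t : Finset α} (h : ShiftRel s t n) :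
    ∃ a ∈ s, ∀ x ∈ t, a < x := by
  obtain ⟨ξ, hξ, rfl, rfl⟩ := h
  refine ⟨ξ (Fin.castSucc ⟨0, Nat.pos_of_ne_zero hn⟩),
    Finset.mem_image_of_mem _ (Finset.mem_univ _), ?_⟩
  intro x hx
  obtain ⟨i, -, rfl⟩ := Finset.mem_image.1 hx
  exact hξ (by simp [Fin.lt_def])

theorem ShiftRel.asymm (hn : n ≠ 0) {s t : Finset α} (h : ShiftRel s t n) : ¬ ShiftRel t s n := by
  intro h'
  obtain ⟨a, ha, hat⟩ := h.exists_lt hn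
  obtain ⟨b, hb, hbs⟩ := h'.exists_lt hn
  exact lt_asymm (hat b hb) (hbs a ha)

theorem shiftRel_insert {m : ℕ} {y : Finset α} (hy : y.card = m) {a c : α}
    (hac : a < c) (ha : ∀ x ∈ y, a < x) (hc : ∀ x ∈ y, x < c) :
    ShiftRel (insert a y) (insert c y) (m + 1) := by
  classical
  let e := y.orderEmbOfFin hy
  have he : ∀ x, x ∈ y ↔ ∃ i, e i = x := by
    intro x
    rw [← Finset.mem_coe, ← Finset.range_orderEmbOfFin y hy]
    rfl
  have hea : ∀ i, a < e i := fun i => ha _ ((he _).2 ⟨i, rfl⟩)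
  have hec : ∀ i, e i < c := fun i => hc _ ((he _).2 ⟨i, rfl⟩)
  -- The sequence is `a`, then `y` in increasing order, then `c`.
  refine ⟨Fin.cons a (Fin.snoc (α := fun _ => α) e c : Fin (m + 1) → α), ?_, ?_, ?_⟩
  · have h1 : StrictMono (Fin.snoc (α := fun _ => α) e c : Fin (m + 1) → α) := by
      intro i j hij
      induction i using Fin.lastCases with
      | last => exact absurd (Fin.le_last j) (not_le.2 hij)
      | cast i =>
        induction j using Fin.lastCases with
        | last => simpa using hec i
        | cast j => simpa using hij
    intro i j hij
    induction i using Fin.cases with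
    | zero =>
      induction j using Fin.cases with
      | zero => exact absurd hij (lt_irrefl _)
      | succ j =>
        induction j using Fin.lastCases with
        | last => simpa using hac
        | cast j => simpa using hea j
    | succ i =>
      induction j using Fin.cases with
      | zero => exact absurd (Fin.zero_le i.succ) (not_le.2 hij)
      | succ j => simpa using h1 (Fin.succ_lt_succ_iff.1 hij)
  · ext x
    simp only [Finset.mem_insert, he, Finset.mem_image, Finset.mem_univ, true_and]
    rw [Fin.exists_fin_succ]
    simp [eq_comm]
  · ext x
    simp only [Finset.mem_insert, he, Finset.mem_image, Finset.mem_univ, true_and]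
    rw [Fin.exists_fin_succ']
    simp [or_comm, eq_comm]

/-- The orientation of the shift graph in which an edge goes upwards if and only if its lower end
belongs to `S c`, for the maximum `c` of its upper end. -/
def shiftOrientation (n : ℕ) (S : α → Set (Finset α)) : Digraph (Set.powersetCard α n) where
  Adj s t :=
    (ShiftRel (s : Finset α) t n ∧ ∃ c ∈ (t : Finset α), (∀ x ∈ (t : Finset α), x ≤ c) ∧
      (s : Finset α) ∈ S c) ∨
    (ShiftRel (t : Finset α) s n ∧ ¬ ∃ c ∈ (s : Finset α), (∀ x ∈ (s : Finset α), x ≤ c) ∧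
      (t : Finset α) ∈ S c)

theorem shiftOrientation_isOrientationOf (hn : n ≠ 0) (S : α → Set (Finset α)) :
    (shiftOrientation n S).IsOrientationOf (shiftGraphOn n α) := by
  refine ⟨?_, fun s t => ?_⟩
  · rintro s t (⟨h, h'⟩ | ⟨h, h'⟩) (⟨k, k'⟩ | ⟨k, k'⟩)
    · exact h.asymm hn k
    · exact k' h'
    · exact h' k'
    · exact h.asymm hn k
  · rw [shiftGraphOn_adj]
    constructor
    · rintro ⟨-, h | h⟩
      · by_cases hc : ∃ c ∈ (t : Finset α), (∀ x ∈ (t : Finset α), x ≤ c) ∧ (s : Finset α) ∈ S c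
        · exact Or.inl (Or.inl ⟨h, hc⟩)
        · exact Or.inr (Or.inr ⟨h, hc⟩)
      · by_cases hc : ∃ c ∈ (s : Finset α), (∀ x ∈ (s : Finset α), x ≤ c) ∧ (t : Finset α) ∈ S c
        · exact Or.inr (Or.inl ⟨h, hc⟩)
        · exact Or.inl (Or.inr ⟨h, hc⟩)
    · intro h
      have hR : ShiftRel (s : Finset α) t n ∨ ShiftRel (t : Finset α) s n := by
        rcases h with (⟨h, -⟩ | ⟨h, -⟩) | (⟨h, -⟩ | ⟨h, -⟩)
        exacts [Or.inl h, Or.inr h, Or.inr h, Or.inl h]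
      refine ⟨?_, hR⟩
      rintro rfl
      rcases hR with h | h <;> exact h.asymm hn h

theorem exists_mem_insert_max_iff {S : α → Set (Finset α)} {y : Finset α} {c : α}
    (hc : ∀ x ∈ y, x < c) {s : Finset α} :
    (∃ d ∈ insert c y, (∀ x ∈ insert c y, x ≤ d) ∧ s ∈ S d) ↔ s ∈ S c := by
  constructor
  · rintro ⟨d, hd, hmax, hs⟩
    rcases Finset.mem_insert.1 hd with rfl | hd
    · exact hs
    · exact absurd (hmax c (Finset.mem_insert_self _ _)) (not_le.2 (hc d hd))
  · intro hs
    refine ⟨c, Finset.mem_insert_self _ _, fun x hx => ?_, hs⟩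
    rcases Finset.mem_insert.1 hx with rfl | hx
    · exact le_rfl
    · exact (hc x hx).le

/-- The unboundedly repeating `S` yields an orientation with monochromatic directed four-cycles. -/
theorem shiftOrientation_arrow {N : Type u} [Infinite N] [Nonempty α] {S : α → Set (Finset α)}
    (hbdd : ∀ f : N → α, ∃ x, ∀ j, f j ≤ x)
    (hS : ∀ (Q : N → Finset α) (x : α), ∃ c, x < c ∧ S c = Set.range Q)
    {m : ℕ} {κ : Cardinal.{u}} (hκ : ℵ₀ ≤ κ) (hN : #N = κ.iterExp m) :
    (shiftOrientation (m + 1) S).Arrow (Digraph.dicycle 4) κ := by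
  classical
  rintro C rfl col
  have : Nonempty C := (infinite_iff.2 hκ).nonempty
  let g : Finset α → C := fun s =>
    if h : s.card = m + 1 then col ⟨s, h⟩ else Classical.arbitrary C
  obtain ⟨i, y, a, a', c, c', hy, hlt, hac, hac', ha'c, ha'c', g1, g2, g3, g4, s1, s2, s3, s4⟩ :=
    exists_monochromatic_pattern hbdd hS hκ hN g
  have ha : ∀ x ∈ y, a < x := fun x hx => (hlt x hx).1
  have ha' : ∀ x ∈ y, a' < x := fun x hx => (hlt x hx).2.1
  have hc : ∀ x ∈ y, x < c := fun x hx => (hlt x hx).2.2.1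
  have hc' : ∀ x ∈ y, x < c' := fun x hx => (hlt x hx).2.2.2
  have card : ∀ b, b ∉ y → (insert b y).card = m + 1 := fun b hb => by
    rw [Finset.card_insert_of_notMem hb, hy]
  have ka := card a fun h => (ha a h).false
  have ka' := card a' fun h => (ha' a' h).false
  have kc := card c fun h => (hc c h).false
  have kc' := card c' fun h => (hc' c' h).false
  have r1 := shiftRel_insert hy hac ha hc
  have r2 := shiftRel_insert hy hac' ha hc'
  have r3 := shiftRel_insert hy ha'c ha' hc
  have r4 := shiftRel_insert hy ha'c' ha' hc'
  have ne : ∀ {s t : Finset α}, ShiftRel s t (m + 1) → s ≠ t := by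
    rintro s t h rfl
    exact h.asymm (Nat.succ_ne_zero m) h
  have n1 := ne r1
  have n2 := ne r2
  have n3 := ne r3
  have n4 := ne r4
  have n5 : insert a y ≠ insert a' y := fun h => s2 (h ▸ s1)
  have n6 : insert c y ≠ insert c' y := by
    intro h
    have h1 : c ∈ insert c' y := h ▸ Finset.mem_insert_self c y
    rcases Finset.mem_insert.1 h1 with rfl | h1
    · exact s2 s3
    · exact (hc c h1).false
  have e1 := exists_mem_insert_max_iff (S := S) hc (s := insert a y)
  have e2 := exists_mem_insert_max_iff (S := S) hc (s := insert a' y)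
  have e3 := exists_mem_insert_max_iff (S := S) hc' (s := insert a y)
  have e4 := exists_mem_insert_max_iff (S := S) hc' (s := insert a' y)
  -- Lower and upper sets alternate: arcs leaving a lower set come from membership in `S`, arcs
  -- returning to one from non-membership.
  let V : Fin 4 → Set.powersetCard α (m + 1) :=
    ![⟨insert a y, ka⟩, ⟨insert c y, kc⟩, ⟨insert a' y, ka'⟩, ⟨insert c' y, kc'⟩]
  have hV : Function.Injective V := by
    intro p q hpq
    have := congrArg Subtype.val hpq
    fin_cases p <;> fin_cases q <;> first
      | rfl
      | exact absurd this n1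
      | exact absurd this n2
      | exact absurd this n3
      | exact absurd this n4
      | exact absurd this n5
      | exact absurd this n6
      | exact absurd this.symm n1
      | exact absurd this.symm n2
      | exact absurd this.symm n3
      | exact absurd this.symm n4
      | exact absurd this.symm n5
      | exact absurd this.symm n6
  refine ⟨i, ⟨V, hV⟩, ?_, ?_⟩
  · intro p
    have hg : ∀ s : Finset α, ∀ h : s.card = m + 1, g s = i → col ⟨s, h⟩ = i := by
      intro s h hs
      simpa [g, h] using hs
    fin_cases p
    exacts [hg _ ka g1, hg _ kc g3, hg _ ka' g2, hg _ kc' g4]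
  · intro p q hpq
    have hq : (q : ℕ) = ((p : ℕ) + 1) % 4 := hpq
    fin_cases p <;> fin_cases q <;> simp at hq
    · exact Or.inl ⟨r1, e1.2 s1⟩
    · exact Or.inr ⟨r3, fun h => s2 (e2.1 h)⟩
    · exact Or.inl ⟨r4, e4.2 s3⟩
    · exact Or.inr ⟨r2, fun h => s4 (e3.1 h)⟩

end Shift

/-! ### Parity of short closed walks. -/

section Parity

variable {n : ℕ} {α : Type u} [LinearOrder α]

theorem card_filter_lt_image {ξ : Fin n → α} (hξ : StrictMono ξ) (i : Fin n) :
    ((Finset.univ.image ξ).filter (· < ξ i)).card = i := by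
  have : (Finset.univ.image ξ).filter (· < ξ i) = (Finset.Iio i).image ξ := by
    ext x
    simp only [Finset.mem_filter, Finset.mem_image, Finset.mem_univ, true_and, Finset.mem_Iio]
    constructor
    · rintro ⟨⟨j, rfl⟩, hj⟩
      exact ⟨j, hξ.lt_iff_lt.1 hj, rfl⟩
    · rintro ⟨j, hj, rfl⟩
      exact ⟨⟨j, rfl⟩, hξ hj⟩
  rw [this, Finset.card_image_of_injective _ hξ.injective, Fin.card_Iio]

theorem ShiftRel.card_filter_lt {s t : Finset α} (h : ShiftRel s t n) {x : α} (hx : x ∈ s)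
    (hpos : 0 < (s.filter (· < x)).card) :
    x ∈ t ∧ (t.filter (· < x)).card + 1 = (s.filter (· < x)).card := by
  obtain ⟨ξ, hξ, rfl, rfl⟩ := h
  obtain ⟨i, -, rfl⟩ := Finset.mem_image.1 hx
  have h1 := card_filter_lt_image (hξ.comp (Fin.strictMono_castSucc)) i
  simp only [Function.comp_def] at h1
  rw [h1] at hpos ⊢
  have hi : ξ i.castSucc = ξ (Fin.succ ⟨i - 1, by omega⟩) := by
    congr 1
    ext
    simp
    omega
  have h2 := card_filter_lt_image (hξ.comp (Fin.strictMono_succ)) (⟨i - 1, by omega⟩ : Fin n)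
  simp only [Function.comp_def] at h2
  rw [hi]
  refine ⟨Finset.mem_image_of_mem _ (Finset.mem_univ _), ?_⟩
  rw [h2]
  exact Nat.sub_add_cancel hpos

theorem ShiftRel.card_filter_lt' {s t : Finset α} (h : ShiftRel s t n) {x : α} (hx : x ∈ t)
    (hlt : (t.filter (· < x)).card + 1 < n) :
    x ∈ s ∧ (s.filter (· < x)).card = (t.filter (· < x)).card + 1 := by
  obtain ⟨ξ, hξ, rfl, rfl⟩ := h
  obtain ⟨i, -, rfl⟩ := Finset.mem_image.1 hx
  have h1 := card_filter_lt_image (hξ.comp (Fin.strictMono_succ)) i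
  simp only [Function.comp_def] at h1
  rw [h1] at hlt ⊢
  have hi : ξ i.succ = ξ (Fin.castSucc ⟨i + 1, hlt⟩) := rfl
  have h2 := card_filter_lt_image (hξ.comp (Fin.strictMono_castSucc)) (⟨i + 1, hlt⟩ : Fin n)
  simp only [Function.comp_def] at h2
  rw [hi]
  exact ⟨Finset.mem_image_of_mem _ (Finset.mem_univ _), h2⟩

/-- Each edge changes the position of `x` by exactly one; the two bounds keep `x` from being shifted
out at either end. -/
theorem shiftGraphOn_walk_even_add {s t : Set.powersetCard α n} (p : (shiftGraphOn n α).Walk s t) :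
    ∀ x ∈ (s : Finset α), p.length ≤ ((s : Finset α).filter (· < x)).card →
      ((s : Finset α).filter (· < x)).card + p.length < n →
      Even (((s : Finset α).filter (· < x)).card + ((t : Finset α).filter (· < x)).card +
        p.length) := by
  induction p with
  | nil => intro x _ _ _; simp
  | cons h p ih =>
    intro x hx h1 h2
    rw [SimpleGraph.Walk.length_cons] at h1 h2 ⊢
    rcases (shiftGraphOn_adj.1 h).2 with h | h
    · obtain ⟨h3, h4⟩ := h.card_filter_lt hx (by omega)
      have := ih x h3 (by omega) (by omega)
      rw [← h4]
      grind
    · obtain ⟨h3, h4⟩ := h.card_filter_lt' hx (by omega)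
      have := ih x h3 (by omega) (by omega)
      rw [h4] at this
      grind

theorem shiftGraphOn_closed_walk_even {s : Set.powersetCard α n} (p : (shiftGraphOn n α).Walk s s)
    (hp : 2 * p.length < n) : Even p.length := by
  have hs : (s : Finset α).card = n := s.2
  have him : Finset.univ.image ((s : Finset α).orderEmbOfFin hs) = (s : Finset α) := by
    simp
  -- The tracked element has `p.length` elements below it and at least as many above, since `2 *
  -- p.length < n`.
  have hpos := card_filter_lt_image ((s : Finset α).orderEmbOfFin hs).strictMono
    ⟨p.length, by omega⟩
  rw [him] at hpos
  have := shiftGraphOn_walk_even_add p _ (Finset.orderEmbOfFin_mem _ hs ⟨p.length, by omega⟩)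
    (by rw [hpos]) (by rw [hpos]; simp only; omega)
  rw [hpos] at this
  grind

end Parity

/-! ### Dichromatic number and arrow relation. -/

section Dichromatic

variable {V : Type u}

theorem Digraph.IsOriented.isAcyclicSet_singleton {D : Digraph V} (hD : D.IsOriented) (x : V) :
    D.IsAcyclicSet {x} := by
  rintro k hk ⟨f, hf, hadj⟩
  have hk1 : k = 1 := by
    by_contra hne
    have h0 : f ⟨0, by omega⟩ = f ⟨1, by omega⟩ := (hf _).trans (hf _).symm
    simpa using f.injective h0
  subst hk1
  have := hadj 0 0 (by simp [Digraph.dicycle])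
  exact hD _ _ this this

theorem Digraph.Arrow.lt_dichromaticNumber {D : Digraph V} (hD : D.IsOriented) {k : ℕ}
    (hk : 1 ≤ k) {κ : Cardinal.{u}} (h : D.Arrow (Digraph.dicycle k) κ) :
    κ < D.dichromaticNumber := by
  by_contra! hle
  -- The infimum is attained only if some acyclic cover exists; singletons form one.
  have hne : {c | ∃ S : Set (Set V), #S = c ∧ ⋃₀ S = Set.univ ∧
      ∀ W ∈ S, D.IsAcyclicSet W}.Nonempty := by
    refine ⟨_, Set.range fun x : V => ({x} : Set V), rfl, ?_, ?_⟩
    · ext x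
      simp
    · rintro _ ⟨x, rfl⟩
      exact hD.isAcyclicSet_singleton x
  obtain ⟨S, hS, hcov, hac⟩ := csInf_mem hne
  have hSκ : #S ≤ #κ.out := by
    rw [hS, mk_out]
    exact hle
  obtain ⟨e⟩ := hSκ
  have hmem : ∀ x : V, ∃ W : S, x ∈ W.1 := fun x => by
    obtain ⟨W, hW, hx⟩ := Set.mem_sUnion.1 (hcov ▸ Set.mem_univ x)
    exact ⟨⟨W, hW⟩, hx⟩
  choose W hW using hmem
  obtain ⟨i, f, hf, hadj⟩ := h κ.out (mk_out κ) fun x => e (W x)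
  refine hac _ (W (f ⟨0, hk⟩)).2 k hk ⟨f, fun y => ?_, hadj⟩
  have : W (f y) = W (f ⟨0, hk⟩) := e.injective ((hf y).trans (hf _).symm)
  rw [← this]
  exact hW _

theorem Digraph.IsOrientationOf.toSimpleGraphInclusive_eq {D : Digraph V} {G : SimpleGraph V}
    (h : D.IsOrientationOf G) : D.toSimpleGraphInclusive = G := by
  ext a b
  rw [Digraph.toSimpleGraphInclusive, SimpleGraph.fromRel_adj, h.2 a b]
  refine ⟨fun h => h.2, fun hab => ⟨?_, hab⟩⟩
  rintro rfl
  rcases hab with hab | hab <;> exact h.1 _ _ hab hab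

end Dichromatic

/-! ### Assembling the three statements. -/

/-- The orientation of the shift graph on `exp_n(κ)` with monochromatic directed four-cycles. -/
theorem exists_shiftGraph_orientation_arrow {n : ℕ} (hn : n ≠ 0) {κ : Cardinal.{u}}
    (hκ : ℵ₀ ≤ κ) : ∃ D : Digraph (Set.powersetCard (κ.iterExp n).ord.ToType n),
      D.IsOrientationOf (shiftGraph n (κ.iterExp n)) ∧ D.Arrow (Digraph.dicycle 4) κ := by
  obtain ⟨m, rfl⟩ := Nat.exists_eq_succ_of_ne_zero hn
  obtain ⟨N, hN⟩ : ∃ N : Type u, #N = κ.iterExp m := ⟨_, mk_out _⟩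
  have hNinf : ℵ₀ ≤ #N := hN ▸ hκ.trans (le_iterExp κ m)
  have : Infinite N := infinite_iff.2 hNinf
  have hpow : κ.iterExp m.succ = 2 ^ #N := by rw [hN]; rfl
  rw [hpow]
  obtain ⟨S, hS⟩ := exists_range_eq_unboundedly (N := N)
  have : Nonempty ((2 : Cardinal.{u}) ^ #N).ord.ToType := by
    rw [← mk_ne_zero_iff, mk_ord_toType]
    exact (power_pos _ two_pos).ne'
  exact ⟨shiftOrientation (m + 1) S, shiftOrientation_isOrientationOf hn S,
    shiftOrientation_arrow (exists_bound_of_mk_lt_cof (lt_cof_ord_power hNinf one_lt_two)) hS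
      hκ hN⟩

/-- Digraphs of large dichromatic number without short odd closed walks. -/
theorem exists_dichromaticNumber_gt_closed_walk_even (κ : Cardinal.{u}) (k : ℕ) :
    ∃ (V : Type u) (D : Digraph V), D.IsOriented ∧ κ < D.dichromaticNumber ∧
      ∀ (a : V) (p : D.toSimpleGraphInclusive.Walk a a), p.length ≤ k → Even p.length := by
  -- `2 * k + 1` leaves room for `k` moves either way; the maximum with `ℵ₀` covers finite `κ`.
  obtain ⟨D, hD, harrow⟩ := exists_shiftGraph_orientation_arrow (n := 2 * k + 1)
    (Nat.succ_ne_zero _) (le_max_right κ ℵ₀)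
  refine ⟨_, D, hD.1, (le_max_left κ ℵ₀).trans_lt (harrow.lt_dichromaticNumber hD.1 (by simp)), ?_⟩
  rw [hD.toSimpleGraphInclusive_eq]
  intro a p hp
  exact shiftGraphOn_closed_walk_even p (Nat.lt_succ_of_le (Nat.mul_le_mul_left 2 hp))

theorem mainTheorem7 :
    -- the shift graphs
    (∀ n : ℕ, 2 ≤ n → ∀ κ : Cardinal.{u}, ℵ₀ ≤ κ →
      (∃ D : Digraph (Set.powersetCard (κ.iterExp n).ord.ToType n),
        D.IsOrientationOf (shiftGraph n (κ.iterExp n)) ∧ D.Arrow (Digraph.dicycle 4) κ) ∧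
      κ < (shiftGraph n (κ.iterExp n)).orientationDichromaticNumber) ∧
    -- large dichromatic number and large odd girth of the underlying graph
    (∀ (κ : Cardinal.{u}) (k : ℕ), ∃ (V : Type u) (D : Digraph V),
      D.IsOriented ∧ κ < D.dichromaticNumber ∧
        (k : ℕ∞) < D.toSimpleGraphInclusive.oddGirth) ∧
    -- obligatory subdigraphs are bipartite
    (∀ (W : Type v) (F : Digraph W), F.IsOriented →
      (∀ (V : Type u) (D : Digraph V), D.IsOriented → ℵ₀ < D.dichromaticNumber → F.Embeds D) →
        F.toSimpleGraphInclusive.IsBipartite) := by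
  refine ⟨fun n hn κ hκ => ?_, fun κ k => ?_, fun W F _ hF => ?_⟩
  · obtain ⟨D, hD, harrow⟩ := exists_shiftGraph_orientation_arrow (n := n) (by omega) hκ
    refine ⟨⟨D, hD, harrow⟩, (harrow.lt_dichromaticNumber hD.1 (by simp)).trans_le ?_⟩
    exact le_ciSup (f := fun D : {D : Digraph (Set.powersetCard (κ.iterExp n).ord.ToType n) //
      D.IsOrientationOf (shiftGraph n (κ.iterExp n))} => D.1.dichromaticNumber)
      bddAbove_of_small ⟨D, hD⟩
  · obtain ⟨V, D, hD, hlt, hev⟩ := exists_dichromaticNumber_gt_closed_walk_even κ k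
    refine ⟨V, D, hD, hlt, lt_of_lt_of_le (b := ((k + 1 : ℕ) : ℕ∞))
      (by exact_mod_cast k.lt_succ_self) ?_⟩
    refine le_iInf fun a => le_iInf fun p => le_iInf fun hp => ?_
    by_contra! hlen
    have hlen' : p.length < k + 1 := by exact_mod_cast hlen
    exact Nat.not_even_iff_odd.2 hp.2 (hev a p (by omega))
  · refine SimpleGraph.two_colorable_iff_forall_loop_even.2 fun a p => ?_
    -- The target depends on the walk: it has no odd closed walk of length at most `p.length`, so
    -- the image of `p` is even.
    obtain ⟨V, D, hD, hlt, hev⟩ := exists_dichromaticNumber_gt_closed_walk_even ℵ₀ p.length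
    obtain ⟨f, -, hf⟩ := hF V D hD hlt
    let φ : F.toSimpleGraphInclusive →g D.toSimpleGraphInclusive :=
      { toFun := f
        map_rel' := fun {x y} h =>
          ⟨fun he => h.1 (f.injective he), h.2.imp (hf x y) (hf y x)⟩ }
    simpa using hev _ (p.map φ) (by simp)
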